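/- **Theorem (Correctness of BSM for the insertion case).** Let $G=(V,E)$ be a finite, simple, connected, undirected graph, let $u\neq v$ be two non-adjacent nodes of $G$, and let $G'=(V,E\cup\{e\})$ be obtained by inserting the edge $e=(u,v)$. Let $\Gamma$ and $\Gamma'$ be the sets of all spanning trees of $G$ and of $G'$, and let $\Gamma'_e\subseteq\Gamma'$ be the set of spanning trees of $G'$ that contain $e$. Let $R(e)$ be the effective resistance between $u$ and $v$ in $G'$ (with unit edge resistances): $R(e)=\varphi(u)-\varphi(v)$ for any $\varphi:V\to\mathbb{R}$ with $L'\varphi=\mathbf 1_u-\mathbf 1_v$, where $L'=D'-A'$ is the Laplacian of $G'$. For a nonempty finite set $S$ let $U(S)$ denote the uniform distribution on $S$. Then $\Gamma$, $\Gamma'$ and $\Gamma'_e$ are nonempty, and for every real-valued function $f$ on trees on the node set $V$, $$\mathbb{E}_{\tau\sim U(\Gamma')}[f(\tau)]=(1-R(e))\,\mathbb{E}_{\tau\sim U(\Gamma)}[f(\tau)]+R(e)\,\mathbb{E}_{\tau\sim U(\Gamma'_e)}[f(\tau)].$$ In particular this holds, for every root $r\in V$ and every choice of simple paths $\mathcal{P}_w$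 in $G'$ from $w$ to $r$ ($w\neq r$), for the function $$f(\tau)=\sum_{w\neq r}d(w)\Bigl(\sum_{F\in\mathbb{F}^{\mathcal{P}_w}(\tau)}\mathrm{vol}(T_1(F))-\sum_{F\in\mathbb{F}^{\mathcal{P}_w'}(\tau)}\mathrm{vol}(T_1(F))\Bigr).$$ Here $d$ is the degree in $G'$; $\mathbb{F}^{\mathcal{P}_w}(\tau)$ (respectively $\mathbb{F}^{\mathcal{P}_w'}(\tau)$) is the set of forests obtained from $\tau$ by deleting one edge that is traversed both by $\mathcal{P}_w$ and by the path of $\tau$ from $w$ to $r$, in the same direction (respectively in opposite directions); $T_1(F)$ is the node set of the tree of $F$ that contains $r$; and $\mathrm{vol}(T_1)=\sum_{x\in T_1}d(x)$. -/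

import Mathlib

open scoped BigOperators

noncomputable section

namespace BSM

variable {V : Type*} [Fintype V]

open Classical in
/-- The set of all spanning trees of `G`; a spanning tree is a tree on the whole node set `V`
all of whose edges are edges of `G`. -/
def spanningTrees (G : SimpleGraph V) : Finset (SimpleGraph V) :=
  {T | T ≤ G ∧ T.IsTree}

open Classical in
/-- The set of all spanning trees of `G` that contain the edge `(u, v)`. -/
def spanningTreesWith (G : SimpleGraph V) (u v : V) : Finset (SimpleGraph V) :=
  {T ∈ spanningTrees G | T.Adj u v}

/-- The graph obtained from `G` by inserting the edge `(u, v)`. -/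
def insertEdge (G : SimpleGraph V) (u v : V) : SimpleGraph V :=
  G ⊔ SimpleGraph.edge u v

open Classical in
/-- `φ` is a potential that sends a unit electric current from `u` to `v` through `G`, every edge
of which is a unit resistor: `L φ = 1_u - 1_v`, where `L = D - A` is the Laplacian of `G`. -/
def IsUnitCurrentPotential (G : SimpleGraph V) (u v : V) (φ : V → ℝ) : Prop :=
  (G.lapMatrix ℝ).mulVec φ = Pi.single u 1 - Pi.single v 1

open Classical in
/-- The effective resistance between `u` and `v` in `G`: the potential difference between `u` and
`v` when a unit current is sent from `u` to `v`. On a connected graph such a potential exists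
(`exists_isUnitCurrentPotential`), and the value does not depend on which one is chosen
(`effectiveResistance_eq`). -/
def effectiveResistance (G : SimpleGraph V) (u v : V) : ℝ :=
  if h : ∃ φ : V → ℝ, IsUnitCurrentPotential G u v φ then h.choose u - h.choose v else 0

open Classical in
theorem effectiveResistance_eq {G : SimpleGraph V} (hG : G.Connected) {u v : V} {φ : V → ℝ}
    (hφ : IsUnitCurrentPotential G u v φ) : effectiveResistance G u v = φ u - φ v := by
  have h : ∃ φ : V → ℝ, IsUnitCurrentPotential G u v φ := ⟨φ, hφ⟩
  have hc := h.choose_spec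
  rw [effectiveResistance, dif_pos h]
  have h0 : (G.lapMatrix ℝ).mulVec (h.choose - φ) = 0 := by
    unfold IsUnitCurrentPotential at hc hφ
    rw [Matrix.mulVec_sub]
    exact sub_eq_zero.mpr (hc.trans hφ.symm)
  have h1 := (G.lapMatrix_mulVec_eq_zero_iff_forall_reachable).mp h0 u v (hG u v)
  simp only [Pi.sub_apply] at h1
  linarith

open Classical in
theorem exists_isUnitCurrentPotential {G : SimpleGraph V} (hG : G.Connected) (u v : V) :
    ∃ φ : V → ℝ, IsUnitCurrentPotential G u v φ := by
  have : Nonempty V := ⟨u⟩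
  -- `L + J`, with `J` the all-ones matrix, is injective, hence surjective
  let M : (V → ℝ) →ₗ[ℝ] (V → ℝ) :=
    (Matrix.toLin' (G.lapMatrix ℝ + Matrix.of fun _ _ => (1 : ℝ)))
  have hM : ∀ x i, M x i = (G.lapMatrix ℝ).mulVec x i + ∑ j, x j := by
    intro x i
    simp [M, Matrix.mulVec, dotProduct]
  have hsum : ∀ x : V → ℝ, ∑ i, (G.lapMatrix ℝ).mulVec x i = 0 := by
    intro x
    have h1 : (1 : V → ℝ) ⬝ᵥ (G.lapMatrix ℝ).mulVec x = 0 := by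
      rw [Matrix.dotProduct_mulVec, ← Matrix.mulVec_transpose, (G.isSymm_lapMatrix (R := ℝ)).eq]
      have : (G.lapMatrix ℝ).mulVec (1 : V → ℝ) = 0 := G.lapMatrix_mulVec_const_eq_zero
      rw [this, zero_dotProduct]
    simpa [dotProduct] using h1
  have key : ∀ x : V → ℝ, ∑ i, M x i = Fintype.card V * ∑ j, x j := by
    intro x
    simp only [hM, Finset.sum_add_distrib, hsum]
    simp
  have hcard : (Fintype.card V : ℝ) ≠ 0 := by exact_mod_cast Fintype.card_ne_zero
  have hinj : Function.Injective M := by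
    rw [← LinearMap.ker_eq_bot, LinearMap.ker_eq_bot']
    intro x hx
    have hs : ∑ j, x j = 0 := by
      have := key x
      rw [hx] at this
      simpa [hcard] using this.symm
    have h0 : (G.lapMatrix ℝ).mulVec x = 0 := by
      funext i
      have := hM x i
      rw [hx, hs] at this
      simpa using this.symm
    have hc := (G.lapMatrix_mulVec_eq_zero_iff_forall_reachable).mp h0
    funext i
    have : ∑ j, x j = Fintype.card V * x i := by
      rw [Finset.sum_congr rfl fun j _ => hc j i (hG j i)]
      simp
    rw [hs] at this
    simpa [hcard] using this.symm
  obtain ⟨φ, hφ⟩ := LinearMap.surjective_of_injective hinj (Pi.single u 1 - Pi.single v 1)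
  refine ⟨φ, ?_⟩
  have hs : ∑ j, φ j = 0 := by
    have := key φ
    rw [hφ] at this
    simpa [hcard] using this.symm
  unfold IsUnitCurrentPotential
  funext i
  have := hM φ i
  rw [hφ, hs, add_zero] at this
  exact this.symm

/-- `T` has a simple path from `u` to `r` that traverses the edge `(i, j)` from `i` to `j`.
(If `T` is a tree, the path is the unique one.) -/
def TreePathTraverses (T : SimpleGraph V) (u r i j : V) : Prop :=
  ∃ q : T.Walk u r, q.IsPath ∧ (i, j) ∈ q.darts.map (·.toProd)

open Classical in
/-- Forward path mapping: the 2-forests obtained from `T` by deleting an edge that the path `p`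
and the path of `T` from `u` to `r` traverse in the same direction. -/
def forwardForests {G : SimpleGraph V} {u r : V} (p : G.Path u r) (T : SimpleGraph V) :
    Finset (SimpleGraph V) :=
  {F | ∃ i j, (i, j) ∈ p.1.darts.map (·.toProd) ∧ TreePathTraverses T u r i j ∧
    F = T.deleteEdges {s(i, j)}}

open Classical in
/-- Reverse path mapping: the 2-forests obtained from `T` by deleting an edge that the path `p`
and the path of `T` from `u` to `r` traverse in opposite directions. -/
def reverseForests {G : SimpleGraph V} {u r : V} (p : G.Path u r) (T : SimpleGraph V) :
    Finset (SimpleGraph V) :=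
  {F | ∃ i j, (i, j) ∈ p.1.darts.map (·.toProd) ∧ TreePathTraverses T u r j i ∧
    F = T.deleteEdges {s(i, j)}}

open Classical in
/-- The volume `∑ d(w)`, with the degrees taken in `G`, of the tree of the forest `F` that
contains `r`. -/
def rootVolume (G F : SimpleGraph V) (r : V) : ℝ :=
  ∑ w with F.Reachable r w, (G.degree w : ℝ)

open Classical in
/-- The quantity `f(T)` computed on a tree `T`, for the graph `G`, the root `r` and the fixed
simple paths `P w` from the nodes `w` to `r` (the path from `r` to itself is not used). -/
def treeValue (G : SimpleGraph V) (r : V) (P : ∀ w, G.Path w r) (T : SimpleGraph V) : ℝ :=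
  ∑ w with w ≠ r, (G.degree w : ℝ) *
    (∑ F ∈ forwardForests (P w) T, rootVolume G F r -
      ∑ F ∈ reverseForests (P w) T, rootVolume G F r)

/-- The expectation of `f` under the uniform distribution on the nonempty finite set `S`, in which
each element of `S` has probability `1 / |S|`. -/
def uniformExpectation {α : Type*} (S : Finset α) (f : α → ℝ) : ℝ :=
  ∑ τ ∈ S, (1 / (S.card : ℝ)) * f τ

end BSM

end

/-!
Fix `u` and `v` in a connected graph `H` with `t` spanning trees, and let `N x` be the number of
spanning forests of `H` with two trees, one containing `u` and `x` and the other `v`. For an edge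
`(x, y)` of `H`, the forests counted by `N x` but not by `N y` separate `u, x` from `y, v`; adding
`(x, y)` turns them into the spanning trees whose path from `u` to `v` traverses `(x, y)`. Hence
`N x - N y` is the net number of such paths through `(x, y)`. Each path is a unit flow, so by
Kirchhoff's node law `L N = t • (1_u - 1_v)`, and the effective resistance is `N u / t`. When
`(u, v)` is an edge, the same bijection makes `N u` the number of spanning trees that contain it.

Thus `R(e)` is the probability that a uniform spanning tree of `G'` contains `e`. The spanning trees
of `G'` without `e` being those of `G`, the theorem is the law of total expectation.
-/

namespace BSM

open scoped Finset

section Reachability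

variable {V : Type*} {G F : SimpleGraph V} {a b u v x y z : V}

theorem reachable_deleteEdges_or_of_reachable (b : V) (h : G.Reachable a z) :
    (G.deleteEdges {s(a, b)}).Reachable a z ∨ (G.deleteEdges {s(a, b)}).Reachable b z := by
  rw [SimpleGraph.reachable_iff_reflTransGen] at h
  induction h with
  | refl => exact .inl .rfl
  | @tail c d _ hcd ih =>
    by_cases hedge : s(c, d) = s(a, b)
    · obtain rfl | rfl : d = a ∨ d = b := by
        rcases Sym2.eq_iff.mp hedge with ⟨-, hd⟩ | ⟨-, hd⟩
        exacts [.inr hd, .inl hd]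
      exacts [.inl .rfl, .inr .rfl]
    · have hstep : (G.deleteEdges {s(a, b)}).Reachable c d :=
        SimpleGraph.Adj.reachable (SimpleGraph.deleteEdges_adj.mpr ⟨hcd, hedge⟩)
      exact ih.imp (·.trans hstep) (·.trans hstep)

theorem reachable_deleteEdges_of_mem_darts {p : G.Walk u v} (hp : p.IsTrail)
    (hxy : (x, y) ∈ p.darts.map (·.toProd)) :
    (G.deleteEdges {s(x, y)}).Reachable u x ∧ (G.deleteEdges {s(x, y)}).Reachable y v := by
  obtain ⟨⟨_, hadj⟩, hdart, rfl⟩ := List.mem_map.mp hxy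
  obtain ⟨before, after, rfl⟩ := (p.isSubwalk_toWalk_iff_mem_darts hadj).mpr hdart
  have hnodup := hp.edges_nodup
  simp only [SimpleGraph.Walk.edges_append, SimpleGraph.Adj.edges_toWalk, List.append_assoc,
    List.singleton_append] at hnodup
  obtain ⟨hnot, -⟩ := List.nodup_cons.mp (List.nodup_middle.mp hnodup)
  rw [List.mem_append, not_or] at hnot
  simp only [SimpleGraph.reachable_deleteEdges_iff_exists_walk]
  exact ⟨⟨before, hnot.1⟩, ⟨after, hnot.2⟩⟩

theorem sup_edge_adj (G : SimpleGraph V) (hab : a ≠ b) : (G ⊔ SimpleGraph.edge a b).Adj a b :=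
  .inr (by simp [SimpleGraph.edge_adj, hab])

/-- `F` is a spanning forest with exactly two trees, one containing `a` and the other `b`. -/
structure IsSeparatingForest (F : SimpleGraph V) (a b : V) : Prop where
  isAcyclic : F.IsAcyclic
  not_reachable : ¬ F.Reachable a b
  reachable_or_reachable : ∀ z, F.Reachable a z ∨ F.Reachable b z

theorem IsSeparatingForest.congr (hux : F.Reachable u x) (hvy : F.Reachable v y)
    (h : IsSeparatingForest F u v) : IsSeparatingForest F x y where
  isAcyclic := h.isAcyclic
  not_reachable hxy := h.not_reachable (hux.trans (hxy.trans hvy.symm))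
  reachable_or_reachable z := (h.reachable_or_reachable z).imp hux.symm.trans hvy.symm.trans

theorem IsSeparatingForest.not_adj (h : IsSeparatingForest F a b) : ¬ F.Adj a b :=
  fun hab => h.not_reachable hab.reachable

theorem IsSeparatingForest.not_reachable_left_iff (h : IsSeparatingForest F a b) :
    ¬ F.Reachable a z ↔ F.Reachable z b :=
  ⟨fun hz => ((h.reachable_or_reachable z).resolve_left hz).symm,
    fun hzb haz => h.not_reachable (haz.trans hzb)⟩

theorem IsSeparatingForest.isTree_sup_edge (h : IsSeparatingForest F a b) :
    (F ⊔ SimpleGraph.edge a b).IsTree := by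
  have hne : a ≠ b := fun hab => h.not_reachable (hab ▸ .rfl)
  have hab : (F ⊔ SimpleGraph.edge a b).Reachable a b :=
    (sup_edge_adj F hne).reachable
  refine ⟨(SimpleGraph.connected_iff_exists_forall_reachable _).mpr ⟨a, fun z => ?_⟩,
    h.isAcyclic.sup_edge_of_not_reachable h.not_reachable⟩
  exact (h.reachable_or_reachable z).elim (·.mono le_sup_left)
    fun hbz => hab.trans (hbz.mono le_sup_left)

theorem isSeparatingForest_deleteEdges {T : SimpleGraph V} (hT : T.IsTree) (hab : T.Adj a b) :
    IsSeparatingForest (T.deleteEdges {s(a, b)}) a b where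
  isAcyclic := hT.isAcyclic.anti (SimpleGraph.deleteEdges_le _)
  not_reachable := SimpleGraph.isAcyclic_iff_forall_adj_isBridge.mp hT.isAcyclic hab
  reachable_or_reachable z := reachable_deleteEdges_or_of_reachable b (hT.connected a z)

theorem deleteEdges_sup_edge (hab : G.Adj a b) :
    G.deleteEdges {s(a, b)} ⊔ SimpleGraph.edge a b = G :=
  sdiff_sup_cancel ((SimpleGraph.edge_le_iff G).mpr (.inr hab))

theorem sup_edge_deleteEdges (hab : ¬ G.Adj a b) :
    (G ⊔ SimpleGraph.edge a b).deleteEdges {s(a, b)} = G :=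
  ((SimpleGraph.disjoint_edge G).mpr hab).sup_sdiff_cancel_right

end Reachability

section PathCurrent

variable {V : Type*} {G T : SimpleGraph V} {u v x y : V}

open scoped Classical in
theorem sum_count_darts_sub [Fintype V] {R : Type*} [AddCommGroupWithOne R] (p : G.Walk u v)
    (x : V) :
    ∑ y, (((p.darts.map (·.toProd)).count (x, y) : R) - (p.darts.map (·.toProd)).count (y, x)) =
      (Pi.single u 1 - Pi.single v 1 : V → R) x := by
  induction p with
  | nil => simp
  | @cons u w v h p ih =>
    have hstep : ∑ y, ((if (u, w) = (x, y) then 1 else 0) -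
        (if (u, w) = (y, x) then 1 else 0) : R) = (Pi.single u 1 - Pi.single w 1 : V → R) x := by
      simp [Finset.sum_sub_distrib, Prod.mk.injEq, ite_and, Pi.single_apply, eq_comm]
    simp only [SimpleGraph.Walk.darts_cons, List.map_cons, List.count_cons, beq_iff_eq,
      Nat.cast_add, Nat.cast_ite, Nat.cast_one, Nat.cast_zero, add_sub_add_comm,
      Finset.sum_add_distrib, ih, hstep]
    simp only [Pi.sub_apply]
    abel

theorem TreePathTraverses.adj (h : TreePathTraverses T u v x y) : T.Adj x y := by
  obtain ⟨p, -, hxy⟩ := h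
  obtain ⟨⟨_, hadj⟩, -, rfl⟩ := List.mem_map.mp hxy
  exact hadj

theorem treePathTraverses_iff_mem_darts (hT : T.IsAcyclic) {p : T.Walk u v} (hp : p.IsPath) :
    TreePathTraverses T u v x y ↔ (x, y) ∈ p.darts.map (·.toProd) := by
  refine ⟨fun ⟨q, hq, hxy⟩ => ?_, fun hxy => ⟨p, hp, hxy⟩⟩
  have hqp : q = p := congrArg Subtype.val ((hT.subsingleton_path u v).elim ⟨q, hq⟩ ⟨p, hp⟩)
  exact hqp ▸ hxy

theorem treePathTraverses_iff_reachable_deleteEdges (hT : T.IsAcyclic) :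
    TreePathTraverses T u v x y ↔ T.Adj x y ∧
      (T.deleteEdges {s(x, y)}).Reachable u x ∧ (T.deleteEdges {s(x, y)}).Reachable y v := by
  constructor
  · intro h
    have hadj := h.adj
    obtain ⟨p, hp, hxy⟩ := h
    exact ⟨hadj, reachable_deleteEdges_of_mem_darts hp.isTrail hxy⟩
  · rintro ⟨hadj, hux, hyv⟩
    have hbridge : ¬ (T.deleteEdges {s(x, y)}).Reachable x y :=
      SimpleGraph.isAcyclic_iff_forall_adj_isBridge.mp hT hadj
    have huv : T.Reachable u v := by
      have hle := SimpleGraph.deleteEdges_le (G := T) {s(x, y)}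
      exact (hux.mono hle).trans (hadj.reachable.trans (hyv.mono hle))
    obtain ⟨p, hp⟩ := huv.exists_isPath
    have hedge : s(x, y) ∈ p.edges := by
      by_contra hnot
      have huv' : (T.deleteEdges {s(x, y)}).Reachable u v :=
        SimpleGraph.reachable_deleteEdges_iff_exists_walk.mpr ⟨p, hnot⟩
      exact hbridge (hux.symm.trans (huv'.trans hyv.symm))
    obtain ⟨d, hd, hdxy⟩ := List.mem_map.mp (p.edges_eq_map_darts ▸ hedge)
    rcases SimpleGraph.dart_edge_eq_mk'_iff.mp hdxy with hforward | hbackward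
    · exact ⟨p, hp, List.mem_map.mpr ⟨d, hd, hforward⟩⟩
    · have huy := (reachable_deleteEdges_of_mem_darts hp.isTrail
        (List.mem_map.mpr ⟨d, hd, hbackward⟩)).1
      rw [Sym2.eq_swap] at huy
      exact absurd (hux.symm.trans huy) hbridge

open scoped Classical in
/-- The net current from `x` to `y` when one unit of current flows from `u` to `v` along the path
of the tree `T`. -/
noncomputable def pathCurrent (T : SimpleGraph V) (u v x y : V) : ℝ :=
  (if TreePathTraverses T u v x y then 1 else 0) - (if TreePathTraverses T u v y x then 1 else 0)

theorem pathCurrent_eq_zero_of_not_adj (hxy : ¬ T.Adj x y) : pathCurrent T u v x y = 0 := by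
  rw [pathCurrent, if_neg fun h => hxy h.adj, if_neg fun h => hxy h.adj.symm, sub_zero]

open scoped Classical in
theorem sum_pathCurrent [Fintype V] (hT : T.IsTree) (u v x : V) :
    ∑ y, pathCurrent T u v x y = (Pi.single u 1 - Pi.single v 1 : V → ℝ) x := by
  obtain ⟨p, hp⟩ := (hT.connected u v).exists_isPath
  have hnodup : (p.darts.map (·.toProd)).Nodup :=
    (List.Nodup.of_map _ hp.isTrail.edges_nodup).map SimpleGraph.Dart.toProd_injective
  rw [← sum_count_darts_sub p x]
  refine Finset.sum_congr rfl fun y _ => ?_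
  simp only [pathCurrent, treePathTraverses_iff_mem_darts hT.isAcyclic hp, hnodup.count,
    Nat.cast_ite, Nat.cast_one, Nat.cast_zero]

end PathCurrent

section SpanningTrees

variable {V : Type*} [Fintype V] {G T : SimpleGraph V} {u v x y : V}

theorem mem_spanningTrees : T ∈ spanningTrees G ↔ T ≤ G ∧ T.IsTree := by
  simp [spanningTrees]

theorem mem_spanningTreesWith :
    T ∈ spanningTreesWith G u v ↔ T ∈ spanningTrees G ∧ T.Adj u v := by
  simp [spanningTreesWith]

theorem spanningTrees_nonempty (hG : G.Connected) : (spanningTrees G).Nonempty := by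
  obtain ⟨T, hle, hT⟩ := hG.exists_isTree_le
  exact ⟨T, mem_spanningTrees.mpr ⟨hle, hT⟩⟩

theorem spanningTreesWith_nonempty (hG : G.Connected) (huv : G.Adj u v) :
    (spanningTreesWith G u v).Nonempty := by
  have hacyclic : (SimpleGraph.edge u v).IsAcyclic := by
    simpa using SimpleGraph.isAcyclic_bot.sup_edge_of_not_reachable
      (SimpleGraph.reachable_bot.not.mpr huv.ne)
  obtain ⟨T, hle, hTG, hT⟩ := hG.exists_isTree_le_of_le_of_isAcyclic
    ((SimpleGraph.edge_le_iff G).mpr (.inr huv)) hacyclic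
  have hadj : T.Adj u v := ((SimpleGraph.edge_le_iff T).mp hle).resolve_left huv.ne
  exact ⟨T, mem_spanningTreesWith.mpr ⟨mem_spanningTrees.mpr ⟨hTG, hT⟩, hadj⟩⟩

open scoped Classical in
/-- The spanning forests of `G` that consist of two trees, one containing `a` and the other `b`. -/
noncomputable def separatingForests (G : SimpleGraph V) (a b : V) : Finset (SimpleGraph V) :=
  {F | F ≤ G ∧ IsSeparatingForest F a b}

theorem mem_separatingForests {F : SimpleGraph V} {a b : V} :
    F ∈ separatingForests G a b ↔ F ≤ G ∧ IsSeparatingForest F a b := by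
  simp [separatingForests]

open scoped Classical in
theorem card_separatingForests_filter_reachable (hxy : G.Adj x y) (u v : V) :
    #{F ∈ separatingForests G u v | F.Reachable u x ∧ F.Reachable y v} =
      #{T ∈ spanningTrees G | TreePathTraverses T u v x y} := by
  have hforest : ∀ F ∈ separatingForests G u v, F.Reachable u x ∧ F.Reachable y v →
      F ≤ G ∧ IsSeparatingForest F x y := by
    rintro F hF ⟨hux, hyv⟩
    obtain ⟨hle, hF⟩ := mem_separatingForests.mp hF
    exact ⟨hle, hF.congr hux hyv.symm⟩
  have htree : ∀ T ∈ spanningTrees G, TreePathTraverses T u v x y → T.Adj x y ∧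
      (T.deleteEdges {s(x, y)}).Reachable u x ∧ (T.deleteEdges {s(x, y)}).Reachable y v :=
    fun T hT => (treePathTraverses_iff_reachable_deleteEdges
      (mem_spanningTrees.mp hT).2.isAcyclic).mp
  refine Finset.card_bij' (fun F _ => F ⊔ SimpleGraph.edge x y)
    (fun T _ => T.deleteEdges {s(x, y)}) ?_ ?_ ?_ ?_ <;> simp only [Finset.mem_filter, and_imp]
  · intro F hF hux hyv
    obtain ⟨hle, hFxy⟩ := hforest F hF ⟨hux, hyv⟩
    have hT := hFxy.isTree_sup_edge
    refine ⟨mem_spanningTrees.mpr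
      ⟨sup_le hle ((SimpleGraph.edge_le_iff G).mpr (.inr hxy)), hT⟩, ?_⟩
    rw [treePathTraverses_iff_reachable_deleteEdges hT.isAcyclic,
      sup_edge_deleteEdges hFxy.not_adj]
    exact ⟨sup_edge_adj F hxy.ne, hux, hyv⟩
  · intro T hT htraverses
    obtain ⟨hadj, hux, hyv⟩ := htree T hT htraverses
    obtain ⟨hle, hT⟩ := mem_spanningTrees.mp hT
    exact ⟨mem_separatingForests.mpr ⟨(SimpleGraph.deleteEdges_le _).trans hle,
      (isSeparatingForest_deleteEdges hT hadj).congr hux.symm hyv⟩, hux, hyv⟩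
  · exact fun F hF hux hyv => sup_edge_deleteEdges (hforest F hF ⟨hux, hyv⟩).2.not_adj
  · exact fun T hT htraverses => deleteEdges_sup_edge (htree T hT htraverses).1

theorem card_separatingForests (huv : G.Adj u v) :
    #(separatingForests G u v) = #(spanningTreesWith G u v) := by
  classical
  have hwith : {T ∈ spanningTrees G | TreePathTraverses T u v u v} = spanningTreesWith G u v := by
    ext T
    simp only [Finset.mem_filter, mem_spanningTreesWith]
    refine and_congr_right fun hT => ?_
    simp [treePathTraverses_iff_reachable_deleteEdges (mem_spanningTrees.mp hT).2.isAcyclic]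
  simpa [hwith] using card_separatingForests_filter_reachable huv u v

end SpanningTrees

section Kirchhoff

variable {V : Type*} [Fintype V] {G : SimpleGraph V} {u v x y : V}

open scoped Classical in
/-- The number of spanning forests of `G` that separate `u` from `v` and join `x` to `u`. Divided
by the number of spanning trees, it is the potential of a unit current from `u` to `v`. -/
noncomputable def forestPotential (G : SimpleGraph V) (u v x : V) : ℝ :=
  #{F ∈ separatingForests G u v | F.Reachable u x}

open scoped Classical in
theorem forestPotential_sub (G : SimpleGraph V) (u v x y : V) :
    forestPotential G u v x - forestPotential G u v y =
      (#{F ∈ separatingForests G u v | F.Reachable u x ∧ F.Reachable y v} : ℝ) -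
        #{F ∈ separatingForests G u v | F.Reachable u y ∧ F.Reachable x v} := by
  have hsplit : ∀ a b, forestPotential G u v a =
      #{F ∈ separatingForests G u v | F.Reachable u a ∧ F.Reachable u b} +
        #{F ∈ separatingForests G u v | F.Reachable u a ∧ F.Reachable b v} := by
    intro a b
    have hright : {F ∈ separatingForests G u v | F.Reachable u a ∧ F.Reachable b v} =
        {F ∈ separatingForests G u v | F.Reachable u a ∧ ¬ F.Reachable u b} :=
      Finset.filter_congr fun F hF => and_congr_right' <|
        (mem_separatingForests.mp hF).2.not_reachable_left_iff.symm
    rw [hright, ← Finset.filter_filter, ← Finset.filter_filter, ← Nat.cast_add,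
      Finset.card_filter_add_card_filter_not, forestPotential]
  rw [hsplit x y, hsplit y x]
  simp only [and_comm (a := SimpleGraph.Reachable _ u y) (b := SimpleGraph.Reachable _ u x)]
  abel

theorem forestPotential_sub_eq_sum_pathCurrent (hxy : G.Adj x y) (u v : V) :
    forestPotential G u v x - forestPotential G u v y =
      ∑ T ∈ spanningTrees G, pathCurrent T u v x y := by
  classical
  simp only [forestPotential_sub, card_separatingForests_filter_reachable hxy,
    card_separatingForests_filter_reachable hxy.symm, pathCurrent, Finset.sum_sub_distrib,
    Finset.sum_boole]

open scoped Classical in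
theorem lapMatrix_mulVec_forestPotential (G : SimpleGraph V) (u v : V) :
    (G.lapMatrix ℝ).mulVec (forestPotential G u v) =
      (#(spanningTrees G) : ℝ) • (Pi.single u 1 - Pi.single v 1) := by
  funext x
  have hnode : ∀ T ∈ spanningTrees G, ∑ y ∈ G.neighborFinset x, pathCurrent T u v x y =
      (Pi.single u 1 - Pi.single v 1 : V → ℝ) x := by
    intro T hT
    obtain ⟨hle, hT⟩ := mem_spanningTrees.mp hT
    rw [← sum_pathCurrent hT]
    refine Finset.sum_subset (Finset.subset_univ _) fun y _ hy => ?_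
    exact pathCurrent_eq_zero_of_not_adj fun hxy => hy ((G.mem_neighborFinset x y).mpr (hle hxy))
  calc (G.lapMatrix ℝ).mulVec (forestPotential G u v) x
      = ∑ y ∈ G.neighborFinset x, (forestPotential G u v x - forestPotential G u v y) := by
        rw [G.lapMatrix_mulVec_apply, Finset.sum_sub_distrib, Finset.sum_const, nsmul_eq_mul,
          G.card_neighborFinset_eq_degree]
    _ = ∑ y ∈ G.neighborFinset x, ∑ T ∈ spanningTrees G, pathCurrent T u v x y :=
        Finset.sum_congr rfl fun y hy =>
          forestPotential_sub_eq_sum_pathCurrent ((G.mem_neighborFinset x y).mp hy) u v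
    _ = ∑ T ∈ spanningTrees G, ∑ y ∈ G.neighborFinset x, pathCurrent T u v x y :=
        Finset.sum_comm
    _ = ((#(spanningTrees G) : ℝ) • (Pi.single u 1 - Pi.single v 1 : V → ℝ)) x := by
        rw [Finset.sum_congr rfl hnode, Finset.sum_const, nsmul_eq_mul, Pi.smul_apply, smul_eq_mul]

theorem effectiveResistance_eq_card_separatingForests_div (hG : G.Connected) (u v : V) :
    effectiveResistance G u v = #(separatingForests G u v) / #(spanningTrees G) := by
  classical
  have hcard : (#(spanningTrees G) : ℝ) ≠ 0 := by
    exact_mod_cast (spanningTrees_nonempty hG).card_ne_zero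
  have hpotential : IsUnitCurrentPotential G u v
      ((#(spanningTrees G) : ℝ)⁻¹ • forestPotential G u v) := by
    rw [IsUnitCurrentPotential, Matrix.mulVec_smul, lapMatrix_mulVec_forestPotential,
      inv_smul_smul₀ hcard]
  have hu : forestPotential G u v u = #(separatingForests G u v) := by
    simp [forestPotential]
  have hv : forestPotential G u v v = 0 := by
    simp only [forestPotential, Nat.cast_eq_zero, Finset.card_eq_zero, Finset.filter_eq_empty_iff]
    exact fun F hF => (mem_separatingForests.mp hF).2.not_reachable
  rw [effectiveResistance_eq hG hpotential, Pi.smul_apply, Pi.smul_apply, hu, hv, smul_zero,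
    sub_zero, smul_eq_mul, inv_mul_eq_div]

theorem effectiveResistance_eq_card_spanningTreesWith_div (hG : G.Connected) (huv : G.Adj u v) :
    effectiveResistance G u v = #(spanningTreesWith G u v) / #(spanningTrees G) := by
  rw [effectiveResistance_eq_card_separatingForests_div hG, card_separatingForests huv]

end Kirchhoff

section TotalExpectation

theorem uniformExpectation_eq_sum_div {α : Type*} (S : Finset α) (f : α → ℝ) :
    uniformExpectation S f = (∑ a ∈ S, f a) / #S := by
  rw [uniformExpectation, ← Finset.mul_sum, one_div_mul_eq_div]

theorem uniformExpectation_eq_filter_add_filter_not {α : Type*} {S : Finset α} (hS : S.Nonempty)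
    (A : α → Prop) [DecidablePred A] (f : α → ℝ) :
    uniformExpectation S f =
      (1 - #{a ∈ S | A a} / #S) * uniformExpectation {a ∈ S | ¬ A a} f +
        #{a ∈ S | A a} / #S * uniformExpectation {a ∈ S | A a} f := by
  have hweighted : ∀ B : Finset α,
      (#B : ℝ) / #S * uniformExpectation B f = (∑ a ∈ B, f a) / #S := by
    intro B
    obtain rfl | hB := B.eq_empty_or_nonempty
    · simp
    · have hcard : (#B : ℝ) ≠ 0 := by exact_mod_cast hB.card_ne_zero
      rw [uniformExpectation_eq_sum_div]
      field_simp
  have hcompl : 1 - (#{a ∈ S | A a} : ℝ) / #S = #{a ∈ S | ¬ A a} / #S := by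
    have hcard : (#S : ℝ) ≠ 0 := by exact_mod_cast hS.card_ne_zero
    rw [sub_eq_iff_eq_add, ← add_div, ← Nat.cast_add, add_comm,
      Finset.card_filter_add_card_filter_not, div_self hcard]
  rw [hcompl, hweighted, hweighted, ← add_div, add_comm, Finset.sum_filter_add_sum_filter_not,
    uniformExpectation_eq_sum_div]

end TotalExpectation

section InsertEdge

variable {V : Type*} {G : SimpleGraph V} {u v : V}

theorem insertEdge_adj (G : SimpleGraph V) (huv : u ≠ v) : (insertEdge G u v).Adj u v :=
  sup_edge_adj G huv

open scoped Classical in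
theorem spanningTrees_insertEdge_filter_not_adj [Fintype V] (huv : ¬ G.Adj u v) :
    {T ∈ spanningTrees (insertEdge G u v) | ¬ T.Adj u v} = spanningTrees G := by
  ext T
  simp only [Finset.mem_filter, mem_spanningTrees]
  refine ⟨fun ⟨⟨hle, hT⟩, hadj⟩ => ⟨?_, hT⟩,
    fun ⟨hle, hT⟩ => ⟨⟨hle.trans le_sup_left, hT⟩, fun hadj => huv (hle hadj)⟩⟩
  exact Disjoint.left_le_of_le_sup_right hle ((SimpleGraph.disjoint_edge T).mpr hadj)

theorem uniformExpectation_spanningTrees_insertEdge [Fintype V] (hG : G.Connected) (hne : u ≠ v)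
    (huv : ¬ G.Adj u v) (f : SimpleGraph V → ℝ) :
    uniformExpectation (spanningTrees (insertEdge G u v)) f =
      (1 - effectiveResistance (insertEdge G u v) u v) * uniformExpectation (spanningTrees G) f +
        effectiveResistance (insertEdge G u v) u v *
          uniformExpectation (spanningTreesWith (insertEdge G u v) u v) f := by
  classical
  have hconn : (insertEdge G u v).Connected := hG.mono le_sup_left
  have hwith : spanningTreesWith (insertEdge G u v) u v =
      {T ∈ spanningTrees (insertEdge G u v) | T.Adj u v} := by
    ext T
    rw [mem_spanningTreesWith, Finset.mem_filter]
  rw [effectiveResistance_eq_card_spanningTreesWith_div hconn (insertEdge_adj G hne), hwith,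
    ← spanningTrees_insertEdge_filter_not_adj huv]
  exact uniformExpectation_eq_filter_add_filter_not (spanningTrees_nonempty hconn) _ f

end InsertEdge

end BSM

theorem mainTheorem6 {V : Type*} [Fintype V] (G : SimpleGraph V) (hG : G.Connected)
    (u v : V) (huv : u ≠ v) (hnew : ¬ G.Adj u v) :
    (BSM.spanningTrees (BSM.insertEdge G u v)).Nonempty ∧
    (BSM.spanningTrees G).Nonempty ∧
    (BSM.spanningTreesWith (BSM.insertEdge G u v) u v).Nonempty ∧
    (∀ f : SimpleGraph V → ℝ,
      BSM.uniformExpectation (BSM.spanningTrees (BSM.insertEdge G u v)) f =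
        (1 - BSM.effectiveResistance (BSM.insertEdge G u v) u v) *
            BSM.uniformExpectation (BSM.spanningTrees G) f +
          BSM.effectiveResistance (BSM.insertEdge G u v) u v *
            BSM.uniformExpectation (BSM.spanningTreesWith (BSM.insertEdge G u v) u v) f) ∧
    (∀ (r : V) (P : ∀ w, (BSM.insertEdge G u v).Path w r),
      BSM.uniformExpectation (BSM.spanningTrees (BSM.insertEdge G u v))
          (BSM.treeValue (BSM.insertEdge G u v) r P) =
        (1 - BSM.effectiveResistance (BSM.insertEdge G u v) u v) *
            BSM.uniformExpectation (BSM.spanningTrees G)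
              (BSM.treeValue (BSM.insertEdge G u v) r P) +
          BSM.effectiveResistance (BSM.insertEdge G u v) u v *
            BSM.uniformExpectation (BSM.spanningTreesWith (BSM.insertEdge G u v) u v)
              (BSM.treeValue (BSM.insertEdge G u v) r P)) := by
  have hconn : (BSM.insertEdge G u v).Connected := hG.mono le_sup_left
  have hexpectation := BSM.uniformExpectation_spanningTrees_insertEdge hG huv hnew
  exact ⟨BSM.spanningTrees_nonempty hconn, BSM.spanningTrees_nonempty hG,
    BSM.spanningTreesWith_nonempty hconn (BSM.insertEdge_adj G huv), hexpectation,
    fun r P => hexpectation (BSM.treeValue (BSM.insertEdge G u v) r P)⟩
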